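/- Let $(\Omega,\mathcal F,\mathbb P)$ be an atomless probability space, $\mathcal X:=L^\infty(\Omega,\mathcal F,\mathbb P)$, and $n\in\mathbb N$. Let $X_1,\dots,X_n\in\mathcal X$ be initial endowments, $S:=\sum_{i=1}^n X_i$, and let $U_1,\dots,U_n:\mathcal X\to\mathbb R$ be utility functionals. For $Z_1,Z_2\in\mathcal X$ write $Z_1\preccurlyeq_{ICV}Z_2$ if $\mathbb E[\phi(Z_1)]\le\mathbb E[\phi(Z_2)]$ for every non-decreasing concave $\phi:\mathbb R\to\mathbb R$, and $Z_1\prec_{ICV}Z_2$ if, in addition, $\mathbb E[\phi(Z_1)]<\mathbb E[\phi(Z_2)]$ for every non-decreasing strictly concave $\phi:\mathbb R\to\mathbb R$. A functional $U:\mathcal X\to\mathbb R$ is S.S.D. preserving if $Z_1\preccurlyeq_{ICV}Z_2$ implies $U(Z_1)\le U(Z_2)$, and strictly S.S.D. preserving if $Z_1\prec_{ICV}Z_2$ implies $U(Z_1)<U(Z_2)$. Let $\mathcal A:=\{(Y_i)_{i=1}^n\in\mathcal X^n:\sum_{i=1}^n Y_i=S\}$ be the set of allocations. Let $\mathcal A_C\subseteq\mathcal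 A$ be the set of comonotone allocations, i.e. those for which there is an event $A$ of probability one with $[Y_i(\omega_1)-Y_i(\omega_2)]\,[Y_j(\omega_1)-Y_j(\omega_2)]\ge 0$ for all $\omega_1,\omega_2\in A$ and all $i,j$. Let $\mathcal{IR}:=\{(Y_i)\in\mathcal A: U_i(Y_i)\ge U_i(X_i)\ \text{for all } i\}$. Let $\mathcal{PO}$ be the set of $(Y_i^*)\in\mathcal{IR}$ for which there is no $(Y_i)\in\mathcal{IR}$ with $U_i(Y_i)\ge U_i(Y_i^*)$ for all $i$ and at least one strict inequality. Let $\mathcal{CPO}$ be the set of $(Y_i^*)\in\mathcal{IR}\cap\mathcal A_C$ for which there is no $(Y_i)\in\mathcal{IR}\cap\mathcal A_C$ with $U_i(Y_i)\ge U_i(Y_i^*)$ for all $i$ and at least one strict inequality. Suppose that each $U_i$ is concave and S.S.D. preserving, and that for all $i$ and all $Z\in\mathcal X$ the function $\mathbb R\to\mathbb R$, $c\mapsto U_i(Z+c)$, is continuous and strictly increasing with $\lim_{c\to\infty}U_i(Z+c)=\infty$. Then $$\mathcal{PO}\cap\mathcal A_C=\mathcal{CPO}.$$ If, in addition, each $U_i$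 is strictly S.S.D. preserving, then $\mathcal{PO}=\mathcal{CPO}$. -/

import Mathlib

open MeasureTheory Filter Set
open scoped ENNReal

namespace RiskSharing

/-- Every event of positive probability contains an event of strictly smaller positive
probability. (Mathlib's condition that singletons are null is weaker.) -/
def Atomless {Ω : Type*} [MeasurableSpace Ω] (P : Measure Ω) : Prop :=
  ∀ A : Set Ω, MeasurableSet A → 0 < P A →
    ∃ B : Set Ω, MeasurableSet B ∧ B ⊆ A ∧ 0 < P B ∧ P B < P A

/-- The space `L^∞(Ω, F, P)` of essentially bounded random variables (modulo a.s. equality). -/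
abbrev Linf {Ω : Type*} [MeasurableSpace Ω] (P : Measure Ω) : Type _ :=
  Lp ℝ ∞ P

section Orders

variable {Ω : Type*} [MeasurableSpace Ω] {P : Measure Ω}

/-- `Z₂` dominates `Z₁` in the increasing concave order (second-order stochastic dominance).
A concave `φ : ℝ → ℝ` is continuous and `Z₁`, `Z₂` are essentially bounded, so both
expectations exist under a probability measure. -/
def ICVLe (Z₁ Z₂ : Linf P) : Prop :=
  ∀ φ : ℝ → ℝ, Monotone φ → ConcaveOn ℝ univ φ →
    ∫ ω, φ (Z₁ ω) ∂P ≤ ∫ ω, φ (Z₂ ω) ∂P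

/-- Strict domination in the increasing concave order. -/
def ICVLt (Z₁ Z₂ : Linf P) : Prop :=
  ICVLe Z₁ Z₂ ∧
    ∀ φ : ℝ → ℝ, Monotone φ → StrictConcaveOn ℝ univ φ →
      ∫ ω, φ (Z₁ ω) ∂P < ∫ ω, φ (Z₂ ω) ∂P

/-- `U` preserves second-order stochastic dominance. -/
def SSDPreserving (U : Linf P → ℝ) : Prop :=
  ∀ Z₁ Z₂ : Linf P, ICVLe Z₁ Z₂ → U Z₁ ≤ U Z₂

/-- `U` strictly preserves strict second-order stochastic dominance. -/
def StrictlySSDPreserving (U : Linf P → ℝ) : Prop :=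
  ∀ Z₁ Z₂ : Linf P, ICVLt Z₁ Z₂ → U Z₁ < U Z₂

/-- For every `Z`, the map `c ↦ U (Z + c)` on `ℝ` is continuous, strictly increasing, and tends
to `∞` as `c → ∞`. -/
def IncreasingInPremium [IsFiniteMeasure P] (U : Linf P → ℝ) : Prop :=
  ∀ Z : Linf P,
    Continuous (fun c : ℝ => U (Z + Lp.const ∞ P c)) ∧
    StrictMono (fun c : ℝ => U (Z + Lp.const ∞ P c)) ∧
    Tendsto (fun c : ℝ => U (Z + Lp.const ∞ P c)) atTop atTop

end Orders

section Market

variable {Ω : Type*} [MeasurableSpace Ω] {P : Measure Ω} {n : ℕ}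

/-- A random vector is comonotone: any two of its components move in the same direction between
any two states. As the components are classes modulo a.s. equality, the states range over an
event of full probability. -/
def Comonotone (Y : Fin n → Linf P) : Prop :=
  ∃ A : Set Ω, (∀ᵐ ω ∂P, ω ∈ A) ∧
    ∀ ω₁ ∈ A, ∀ ω₂ ∈ A, ∀ i j : Fin n,
      0 ≤ (Y i ω₁ - Y i ω₂) * (Y j ω₁ - Y j ω₂)

/-- The allocations of the aggregate endowment `∑ i, X i`. -/
def allocations (X : Fin n → Linf P) : Set (Fin n → Linf P) :=
  {Y | ∑ i, Y i = ∑ i, X i}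

/-- The comonotone allocations of the aggregate endowment. -/
def comonotoneAllocations (X : Fin n → Linf P) : Set (Fin n → Linf P) :=
  {Y | Y ∈ allocations X ∧ Comonotone Y}

/-- The individually rational allocations. -/
def individuallyRational (U : Fin n → Linf P → ℝ) (X : Fin n → Linf P) :
    Set (Fin n → Linf P) :=
  {Y | Y ∈ allocations X ∧ ∀ i, U i (X i) ≤ U i (Y i)}

/-- `Y` makes every agent at least as well off as `Y'`, and some agent strictly better off. -/
def ParetoDominates (U : Fin n → Linf P → ℝ) (Y Y' : Fin n → Linf P) : Prop :=
  (∀ i, U i (Y' i) ≤ U i (Y i)) ∧ ∃ i, U i (Y' i) < U i (Y i)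

/-- The Pareto-optimal allocations. -/
def paretoOptimal (U : Fin n → Linf P → ℝ) (X : Fin n → Linf P) :
    Set (Fin n → Linf P) :=
  {Y | Y ∈ individuallyRational U X ∧
    ¬ ∃ Y' ∈ individuallyRational U X, ParetoDominates U Y' Y}

/-- The comonotone Pareto-optimal allocations: Pareto optima of the market in which only
comonotone allocations are admissible. -/
def comonotoneParetoOptimal (U : Fin n → Linf P → ℝ) (X : Fin n → Linf P) :
    Set (Fin n → Linf P) :=
  {Y | Y ∈ comonotoneAllocations X ∧ Y ∈ individuallyRational U X ∧
    ¬ ∃ Y' ∈ comonotoneAllocations X,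
      Y' ∈ individuallyRational U X ∧ ParetoDominates U Y' Y}

end Market

end RiskSharing

namespace RiskSharing

/-! Everything rests on comonotone improvement (`exists_comonotone_improvement`): each allocation is
dominated, agent by agent in the concave order, by a comonotone one. A dominating competitor can
thus be made comonotone, so comonotone optima are optima. Under strict preservation, averaging a
non-comonotone allocation with its improvement makes some agent strictly better off, so optima are
comonotone.

The improvements of a bounded allocation form a closed convex set in L², which has a unique element
of least norm. If two of its components were in opposite order on two events of positive
probability, a small mean-zero transfer between the two agents would give a different improvement.
Its norm is no larger, because `-x ^ 2` is concave: a contradiction. -/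

theorem continuous_of_concaveOn {φ : ℝ → ℝ} (hφ : ConcaveOn ℝ univ φ) : Continuous φ :=
  continuousOn_univ.1 (hφ.continuousOn isOpen_univ)

theorem exists_bound_of_continuous {φ : ℝ → ℝ} (hφ : Continuous φ) (M : ℝ) :
    ∃ C, ∀ x, |x| ≤ M → ‖φ x‖ ≤ C := by
  obtain ⟨C, hC⟩ := (isCompact_Icc (a := -M) (b := M)).exists_bound_of_continuousOn
    hφ.continuousOn
  exact ⟨C, fun x hx => hC x (abs_le.1 hx)⟩

/-- A step down that stays to the right of `[p, q]` costs a concave function at most what it costs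
the affine function with the slope of `φ` on `[p, q]`. -/
theorem concaveOn_sub_le {φ : ℝ → ℝ} (hφ : ConcaveOn ℝ univ φ) {p q : ℝ} (hpq : p < q)
    {x s : ℝ} (hs : 0 < s) (hx : q < x - s) :
    φ x - s * ((φ q - φ p) / (q - p)) ≤ φ (x - s) := by
  have h₁ := hφ.slope_anti_adjacent (mem_univ p) (mem_univ (x - s)) hpq hx
  have h₂ := hφ.slope_anti_adjacent (mem_univ q) (mem_univ x) hx (by linarith : x - s < x)
  have h := h₂.trans h₁
  rw [div_le_iff₀ (by linarith)] at h
  linarith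

theorem concaveOn_add_le {φ : ℝ → ℝ} (hφ : ConcaveOn ℝ univ φ) {p q : ℝ} (hpq : p < q)
    {x t : ℝ} (ht : 0 < t) (hx : x + t < p) :
    φ x + t * ((φ q - φ p) / (q - p)) ≤ φ (x + t) := by
  have h₁ := hφ.slope_anti_adjacent (mem_univ (x + t)) (mem_univ q) hx hpq
  have h₂ := hφ.slope_anti_adjacent (mem_univ x) (mem_univ p) (by linarith : x < x + t) hx
  have h := h₁.trans h₂
  rw [le_div_iff₀ (by linarith)] at h
  linarith

/-! ### Mean-zero transfers between two events. -/

section Transfer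

variable {Ω : Type*}

/-- Lower by `s` on `A` and raise by `t` on `B`. -/
noncomputable def transfer (A B : Set Ω) (s t : ℝ) (ω : Ω) : ℝ :=
  B.indicator (fun _ => t) ω - A.indicator (fun _ => s) ω

theorem transfer_swap (A B : Set Ω) (s t : ℝ) (ω : Ω) :
    transfer B A t s ω = -transfer A B s t ω := by
  simp [transfer]

theorem abs_add_transfer_le {f : Ω → ℝ} {A B : Set Ω} {p q s t M : ℝ} (hpq : p < q)
    (hs : 0 < s) (ht : 0 < t) (hA : ∀ ω ∈ A, q < f ω - s) (hB : ∀ ω ∈ B, f ω + t < p)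
    (hqM : q ≤ M) (hpM : -M ≤ p) {ω : Ω} (hω : |f ω| ≤ M) :
    |f ω + transfer A B s t ω| ≤ M := by
  rw [abs_le] at hω ⊢
  unfold transfer
  by_cases h₁ : ω ∈ A <;> by_cases h₂ : ω ∈ B
  · have := hA ω h₁; have := hB ω h₂; linarith
  · have := hA ω h₁; simp only [h₁, h₂, indicator_of_mem, indicator_of_notMem,
      not_false_eq_true]; constructor <;> linarith
  · have := hB ω h₂; simp only [h₁, h₂, indicator_of_mem, indicator_of_notMem,
      not_false_eq_true]; constructor <;> linarith
  · simpa [h₁, h₂] using hω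

end Transfer

section Integrals

variable {Ω : Type*} [MeasurableSpace Ω] {P : Measure Ω} [IsFiniteMeasure P]

theorem integrable_comp_of_bound {φ : ℝ → ℝ} (hφ : Continuous φ) {f : Ω → ℝ}
    (hf : AEStronglyMeasurable f P) {M : ℝ} (hM : ∀ᵐ ω ∂P, |f ω| ≤ M) :
    Integrable (fun ω => φ (f ω)) P := by
  obtain ⟨C, hC⟩ := exists_bound_of_continuous hφ M
  exact Integrable.of_bound (hφ.comp_aestronglyMeasurable hf) C (hM.mono fun ω h => hC _ h)

theorem measurable_transfer {A B : Set Ω} (hA : MeasurableSet A) (hB : MeasurableSet B)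
    (s t : ℝ) : Measurable (transfer A B s t) :=
  (measurable_const.indicator hB).sub (measurable_const.indicator hA)

theorem integral_transfer {A B : Set Ω} (hA : MeasurableSet A) (hB : MeasurableSet B)
    {s t : ℝ} (hst : s * P.real A = t * P.real B) : ∫ ω, transfer A B s t ω ∂P = 0 := by
  unfold transfer
  rw [integral_sub ((integrable_const t).indicator hB) ((integrable_const s).indicator hA),
    integral_indicator_const _ hA, integral_indicator_const _ hB]
  simp only [smul_eq_mul]
  linarith

/-- The single slope `σ` of `φ` on `[p, q]` bounds the change pointwise on both events: `φ (f + τ) ≥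
φ f + σ τ`. The transfer `τ` has mean zero, so the linear term integrates away. -/
theorem integral_comp_le_integral_comp_transfer {φ : ℝ → ℝ} (hφ : ConcaveOn ℝ univ φ)
    {f : Ω → ℝ} (hf : AEStronglyMeasurable f P) {M : ℝ} (hM : ∀ᵐ ω ∂P, |f ω| ≤ M)
    {A B : Set Ω} (hAm : MeasurableSet A) (hBm : MeasurableSet B) {p q s t : ℝ} (hpq : p < q)
    (hs : 0 < s) (ht : 0 < t) (hA : ∀ ω ∈ A, q < f ω - s) (hB : ∀ ω ∈ B, f ω + t < p)
    (hqM : q ≤ M) (hpM : -M ≤ p) (hst : s * P.real A = t * P.real B) :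
    ∫ ω, φ (f ω) ∂P ≤ ∫ ω, φ (f ω + transfer A B s t ω) ∂P := by
  have hc := continuous_of_concaveOn hφ
  have hint : Integrable (transfer A B s t) P :=
    ((integrable_const t).indicator hBm).sub ((integrable_const s).indicator hAm)
  have hi := integrable_comp_of_bound hc hf hM
  have hi' : Integrable (fun ω => φ (f ω + transfer A B s t ω)) P :=
    integrable_comp_of_bound hc
      (hf.add (measurable_transfer hAm hBm s t).aestronglyMeasurable) (M := M)
      (hM.mono fun ω h => abs_add_transfer_le hpq hs ht hA hB hqM hpM h)
  set σ := (φ q - φ p) / (q - p)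
  calc ∫ ω, φ (f ω) ∂P = ∫ ω, (φ (f ω) + transfer A B s t ω * σ) ∂P := by
        rw [integral_add hi (hint.mul_const σ), integral_mul_const,
          integral_transfer hAm hBm hst, zero_mul, add_zero]
    _ ≤ _ := by
      refine integral_mono (hi.add (hint.mul_const σ)) hi' fun ω => ?_
      simp only [transfer]
      by_cases h₁ : ω ∈ A <;> by_cases h₂ : ω ∈ B
      · have := hA ω h₁; have := hB ω h₂; linarith
      · have := concaveOn_sub_le hφ hpq hs (hA ω h₁)
        simp only [h₁, h₂, indicator_of_mem, indicator_of_notMem, not_false_eq_true, zero_sub,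
          ← sub_eq_add_neg]
        linarith
      · have := concaveOn_add_le hφ hpq ht (hB ω h₂)
        simp only [h₁, h₂, indicator_of_mem, indicator_of_notMem, not_false_eq_true, sub_zero]
        linarith
      · simp [h₁, h₂]

end Integrals

/-! ### The set of improvements and its element of least norm. -/

section Improvement

variable {Ω : Type*} [MeasurableSpace Ω] {P : Measure Ω} {n : ℕ}

/-- `z` takes values in `[-M, M]`, has the same total as `y`, and each component of `z` dominates
that of `y` in the concave order. -/
def IsImprovement (P : Measure Ω) (M : ℝ) (y z : Ω → EuclideanSpace ℝ (Fin n)) : Prop :=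
  (∀ᵐ ω ∂P, (∀ i, |z ω i| ≤ M) ∧ ∑ i, z ω i = ∑ i, y ω i) ∧
    ∀ i, ∀ φ : ℝ → ℝ, ConcaveOn ℝ univ φ → ∫ ω, φ (y ω i) ∂P ≤ ∫ ω, φ (z ω i) ∂P

theorem IsImprovement.bound {M : ℝ} {y z : Ω → EuclideanSpace ℝ (Fin n)}
    (h : IsImprovement P M y z) (i : Fin n) : ∀ᵐ ω ∂P, |z ω i| ≤ M :=
  h.1.mono fun _ hω => hω.1 i

theorem IsImprovement.congr {M : ℝ} {y z w : Ω → EuclideanSpace ℝ (Fin n)}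
    (h : IsImprovement P M y z) (hzw : z =ᵐ[P] w) : IsImprovement P M y w := by
  refine ⟨?_, fun i φ hφ => (h.2 i φ hφ).trans_eq (integral_congr_ae ?_)⟩
  · filter_upwards [h.1, hzw] with ω h₁ h₂
    rwa [← h₂]
  · filter_upwards [hzw] with ω h₂
    rw [h₂]

theorem aestronglyMeasurable_coord {z : Ω → EuclideanSpace ℝ (Fin n)}
    (hz : AEStronglyMeasurable z P) (i : Fin n) : AEStronglyMeasurable (fun ω => z ω i) P :=
  (EuclideanSpace.proj (𝕜 := ℝ) i).continuous.comp_aestronglyMeasurable hz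

theorem norm_le_of_abs_le {M : ℝ} {x : EuclideanSpace ℝ (Fin n)} (hx : ∀ i, |x i| ≤ M) :
    ‖x‖ ≤ Real.sqrt (n * M ^ 2) := by
  apply Real.le_sqrt_of_sq_le
  rw [EuclideanSpace.real_norm_sq_eq]
  calc ∑ i, x i ^ 2 ≤ ∑ _i : Fin n, M ^ 2 :=
        Finset.sum_le_sum fun i _ => sq_le_sq' (abs_le.1 (hx i)).1 (abs_le.1 (hx i)).2
    _ = n * M ^ 2 := by simp

variable [IsFiniteMeasure P]

theorem memLp_two_of_abs_le {M : ℝ} {z : Ω → EuclideanSpace ℝ (Fin n)}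
    (hz : AEStronglyMeasurable z P) (hM : ∀ᵐ ω ∂P, ∀ i, |z ω i| ≤ M) : MemLp z 2 P :=
  MemLp.of_bound hz _ (hM.mono fun _ => norm_le_of_abs_le)

/-- The square-integrable improvements of `y`. -/
def improvements (P : Measure Ω) (M : ℝ) (y : Ω → EuclideanSpace ℝ (Fin n)) :
    Set (Lp (EuclideanSpace ℝ (Fin n)) 2 P) :=
  {z | IsImprovement P M y z}

theorem convex_improvements (M : ℝ) (y : Ω → EuclideanSpace ℝ (Fin n)) :
    Convex ℝ (improvements P M y) := by
  intro z hz w hw a b ha hb hab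
  have hco : (fun ω => a • z ω + b • w ω) =ᵐ[P] (a • z + b • w : Lp _ 2 P) := by
    filter_upwards [Lp.coeFn_add (a • z) (b • w), Lp.coeFn_smul a z, Lp.coeFn_smul b w]
      with ω h₁ h₂ h₃
    rw [h₁, Pi.add_apply, h₂, h₃, Pi.smul_apply, Pi.smul_apply]
  refine IsImprovement.congr ⟨?_, fun i φ hφ => ?_⟩ hco
  · filter_upwards [hz.1, hw.1] with ω h₁ h₂
    refine ⟨fun i => ?_, ?_⟩
    · have h₁ := abs_le.1 (h₁.1 i)
      have h₂ := abs_le.1 (h₂.1 i)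
      have hM : M = a * M + b * M := by rw [← add_mul, hab, one_mul]
      simp only [PiLp.add_apply, PiLp.smul_apply, smul_eq_mul]
      rw [abs_le, hM]
      constructor
      · nlinarith [mul_le_mul_of_nonneg_left h₁.1 ha, mul_le_mul_of_nonneg_left h₂.1 hb]
      · exact add_le_add (mul_le_mul_of_nonneg_left h₁.2 ha) (mul_le_mul_of_nonneg_left h₂.2 hb)
    · simp only [PiLp.add_apply, PiLp.smul_apply, smul_eq_mul, Finset.sum_add_distrib,
        ← Finset.mul_sum, h₁.2, h₂.2, ← add_mul, hab, one_mul]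
  · have hc := continuous_of_concaveOn hφ
    have hzm := aestronglyMeasurable_coord (Lp.aestronglyMeasurable z) i
    have hwm := aestronglyMeasurable_coord (Lp.aestronglyMeasurable w) i
    have hiz := integrable_comp_of_bound hc hzm (hz.bound i)
    have hiw := integrable_comp_of_bound hc hwm (hw.bound i)
    have hi : Integrable (fun ω => φ (a * z ω i + b * w ω i)) P := by
      refine integrable_comp_of_bound hc (M := a * M + b * M)
        ((hzm.const_mul a).add (hwm.const_mul b)) ?_
      filter_upwards [hz.bound i, hw.bound i] with ω h₁ h₂
      refine (abs_add_le _ _).trans (add_le_add ?_ ?_)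
      · rw [abs_mul, abs_of_nonneg ha]
        exact mul_le_mul_of_nonneg_left h₁ ha
      · rw [abs_mul, abs_of_nonneg hb]
        exact mul_le_mul_of_nonneg_left h₂ hb
    calc ∫ ω, φ (y ω i) ∂P
        = a * ∫ ω, φ (y ω i) ∂P + b * ∫ ω, φ (y ω i) ∂P := by rw [← add_mul, hab, one_mul]
      _ ≤ a * ∫ ω, φ (z ω i) ∂P + b * ∫ ω, φ (w ω i) ∂P :=
          add_le_add (mul_le_mul_of_nonneg_left (hz.2 i φ hφ) ha)
            (mul_le_mul_of_nonneg_left (hw.2 i φ hφ) hb)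
      _ = ∫ ω, (a * φ (z ω i) + b * φ (w ω i)) ∂P := by
          rw [integral_add (hiz.const_mul a) (hiw.const_mul b), integral_const_mul,
            integral_const_mul]
      _ ≤ _ := integral_mono ((hiz.const_mul a).add (hiw.const_mul b)) hi fun ω =>
          hφ.2 (mem_univ _) (mem_univ _) ha hb hab

/-- An L²-convergent sequence has an a.e. convergent subsequence, and the uniform bound `M` allows
dominated convergence under each `φ`. -/
theorem isClosed_improvements (M : ℝ) (y : Ω → EuclideanSpace ℝ (Fin n)) :
    IsClosed (improvements P M y) := by
  refine IsSeqClosed.isClosed fun u z hu hz => ?_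
  obtain ⟨k, -, hk⟩ := (tendstoInMeasure_of_tendsto_Lp hz).exists_seq_tendsto_ae
  have hk' : ∀ᵐ ω ∂P, ∀ i, Tendsto (fun m => u (k m) ω i) atTop (nhds (z ω i)) := by
    filter_upwards [hk] with ω h i
    exact ((EuclideanSpace.proj (𝕜 := ℝ) i).continuous.tendsto _).comp h
  refine ⟨?_, fun i φ hφ => ?_⟩
  · filter_upwards [hk', ae_all_iff.2 fun m => (hu (k m)).1] with ω h hm
    refine ⟨fun i => le_of_tendsto (h i).abs (Eventually.of_forall fun m => (hm m).1 i), ?_⟩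
    refine tendsto_nhds_unique (tendsto_finsetSum _ fun i _ => h i) ?_
    simp only [fun m => (hm m).2]
    exact tendsto_const_nhds
  · have hc := continuous_of_concaveOn hφ
    obtain ⟨C, hC⟩ := exists_bound_of_continuous hc M
    refine ge_of_tendsto (tendsto_integral_of_dominated_convergence (fun _ => C)
      (fun m => hc.comp_aestronglyMeasurable
        (aestronglyMeasurable_coord (Lp.aestronglyMeasurable (u (k m))) i))
      (integrable_const C)
      (fun m => ((hu (k m)).bound i).mono fun ω h => hC _ h)
      (hk'.mono fun ω h => (hc.tendsto _).comp (h i)))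
      (Eventually.of_forall fun m => (hu (k m)).2 i φ hφ)

/-- Some improvement is the only one among those whose norm does not exceed its own. -/
theorem exists_unique_minimal_improvement {M : ℝ} {y : Ω → EuclideanSpace ℝ (Fin n)}
    (hy : AEStronglyMeasurable y P) (hM : ∀ᵐ ω ∂P, ∀ i, |y ω i| ≤ M) :
    ∃ z ∈ improvements P M y, ∀ w ∈ improvements P M y, ‖w‖ ≤ ‖z‖ → w = z := by
  have hne : (improvements P M y).Nonempty :=
    ⟨(memLp_two_of_abs_le hy hM).toLp y,
      IsImprovement.congr ⟨hM.mono fun ω h => ⟨h, rfl⟩, fun _ _ _ => le_rfl⟩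
        (MemLp.coeFn_toLp _).symm⟩
  obtain ⟨z, hz, hmin⟩ := exists_norm_eq_iInf_of_complete_convex hne
    (isClosed_improvements M y).isComplete (convex_improvements M y) 0
  refine ⟨z, hz, fun w hw hwz => ?_⟩
  -- `z` is the projection of `0`, so `⟪z, w - z⟫ ≥ 0` and hence `‖w‖² ≥ ‖z‖² + ‖w - z‖²`.
  have hin := (norm_eq_iInf_iff_real_inner_le_zero (convex_improvements M y) hz).1 hmin w hw
  have hsq := norm_add_sq_real z (w - z)
  rw [add_sub_cancel] at hsq
  rw [zero_sub, inner_neg_left] at hin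
  have : ‖w‖ ^ 2 ≤ ‖z‖ ^ 2 := pow_le_pow_left₀ (norm_nonneg _) hwz 2
  have h0 : ‖w - z‖ ^ 2 ≤ 0 := by linarith
  exact sub_eq_zero.1 (norm_eq_zero.1 (pow_eq_zero_iff two_ne_zero |>.1
    (le_antisymm h0 (sq_nonneg _))))

theorem norm_sq_eq_sum_integral (z : Lp (EuclideanSpace ℝ (Fin n)) 2 P)
    {M : ℝ} (hM : ∀ i, ∀ᵐ ω ∂P, |z ω i| ≤ M) :
    ‖z‖ ^ 2 = ∑ i, ∫ ω, z ω i ^ 2 ∂P := by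
  rw [← real_inner_self_eq_norm_sq, L2.inner_def, ← integral_finsetSum]
  · simp only [real_inner_self_eq_norm_sq, EuclideanSpace.real_norm_sq_eq]
  · exact fun i _ => integrable_comp_of_bound (continuous_pow 2)
      (aestronglyMeasurable_coord (Lp.aestronglyMeasurable z) i) (hM i)

end Improvement

/-! ### Minimality forces comonotonicity. -/

section Improvement

variable {Ω : Type*} [MeasurableSpace Ω] {P : Measure Ω} {n : ℕ} [IsProbabilityMeasure P]

/-- In an improvement of minimal norm no two components can be in opposite order on two events of
positive probability. -/
theorem measure_eq_zero_or_of_minimal {M : ℝ} {y : Ω → EuclideanSpace ℝ (Fin n)}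
    {z : Lp (EuclideanSpace ℝ (Fin n)) 2 P} (hz : z ∈ improvements P M y)
    (hmin : ∀ w ∈ improvements P M y, ‖w‖ ≤ ‖z‖ → w = z) {i j : Fin n} (hij : i ≠ j)
    {a a' b b' : ℝ} (ha : a < a') (hb : b < b') :
    P {ω | a' < z ω i ∧ z ω j < b} = 0 ∨ P {ω | z ω i < a ∧ b' < z ω j} = 0 := by
  by_contra! hcon
  set A := {ω | a' < z ω i ∧ z ω j < b}
  set B := {ω | z ω i < a ∧ b' < z ω j}
  have hzm := Lp.aestronglyMeasurable z
  have hcm (k : Fin n) : Measurable fun ω => z ω k :=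
    (EuclideanSpace.proj (𝕜 := ℝ) k).continuous.measurable.comp
      (Lp.stronglyMeasurable z).measurable
  have hAm : MeasurableSet A :=
    (measurableSet_lt measurable_const (hcm i)).inter (measurableSet_lt (hcm j) measurable_const)
  have hBm : MeasurableSet B :=
    (measurableSet_lt (hcm i) measurable_const).inter (measurableSet_lt measurable_const (hcm j))
  obtain ⟨ω₁, hω₁, hM₁⟩ :=
    ((frequently_ae_mem_iff.2 hcon.1).and_eventually hz.1).exists
  obtain ⟨ω₂, hω₂, hM₂⟩ :=
    ((frequently_ae_mem_iff.2 hcon.2).and_eventually hz.1).exists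
  have hA0 : 0 < P.real A := ENNReal.toReal_pos hcon.1 (measure_ne_top _ _)
  have hB0 : 0 < P.real B := ENNReal.toReal_pos hcon.2 (measure_ne_top _ _)
  -- Steps of size at most `d`, a third of each gap, leave the values on `A` and `B` separated.
  obtain ⟨d, hd, hda, hdb⟩ : ∃ d : ℝ, 0 < d ∧ 3 * d ≤ a' - a ∧ 3 * d ≤ b' - b :=
    ⟨min (a' - a) (b' - b) / 3, by
      have := lt_min (sub_pos.2 ha) (sub_pos.2 hb)
      positivity, by linarith [min_le_left (a' - a) (b' - b)],
      by linarith [min_le_right (a' - a) (b' - b)]⟩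
  -- Weighting each step by the probability of the opposite event makes the transfer mean-zero.
  set s := d * P.real B
  set t := d * P.real A
  have hs : 0 < s := mul_pos hd hB0
  have ht : 0 < t := mul_pos hd hA0
  have hsd : s ≤ d := mul_le_of_le_one_right hd.le measureReal_le_one
  have htd : t ≤ d := mul_le_of_le_one_right hd.le measureReal_le_one
  have hst : s * P.real A = t * P.real B := by simp only [s, t]; ring
  have h₁i := abs_le.1 (hM₁.1 i)
  have h₁j := abs_le.1 (hM₁.1 j)
  have h₂i := abs_le.1 (hM₂.1 i)
  have h₂j := abs_le.1 (hM₂.1 j)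
  have hiA : ∀ ω ∈ A, a' - d < z ω i - s := fun ω h => by linarith [h.1]
  have hiB : ∀ ω ∈ B, z ω i + t < a + d := fun ω h => by linarith [h.1]
  have hjB : ∀ ω ∈ B, b' - d < z ω j - t := fun ω h => by linarith [h.2]
  have hjA : ∀ ω ∈ A, z ω j + s < b + d := fun ω h => by linarith [h.2]
  have hpi : a + d < a' - d := by linarith
  have hpj : b + d < b' - d := by linarith
  have hqi : a' - d ≤ M := by linarith [hω₁.1]
  have hqi' : -M ≤ a + d := by linarith [hω₂.1]
  have hqj : b' - d ≤ M := by linarith [hω₂.2]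
  have hqj' : -M ≤ b + d := by linarith [hω₁.2]
  set τ := transfer A B s t
  have hτm : Measurable τ := measurable_transfer hAm hBm s t
  -- Agent `i` receives `τ` and agent `j` pays it, so totals are kept; for `j` the events swap
  -- roles.
  set v : EuclideanSpace ℝ (Fin n) := EuclideanSpace.single i 1 - EuclideanSpace.single j 1
    with hv
  have hvi : v i = 1 := by simp [hv, hij]
  have hvj : v j = -1 := by simp [hv, hij.symm]
  have hvk (k : Fin n) (hki : k ≠ i) (hkj : k ≠ j) : v k = 0 := by simp [hv, hki, hkj]
  have hvsum : ∑ k, v k = 0 := by simp [hv, Finset.sum_sub_distrib]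
  set w : Ω → EuclideanSpace ℝ (Fin n) := fun ω => z ω + τ ω • v with hw
  have hwk (k : Fin n) (ω : Ω) : w ω k = z ω k + τ ω * v k := by simp [hw]
  have hwi (ω : Ω) : w ω i = z ω i + transfer A B s t ω := by rw [hwk, hvi, mul_one]
  have hwj (ω : Ω) : w ω j = z ω j + transfer B A t s ω := by
    rw [hwk, hvj, transfer_swap, mul_neg_one]
  have hwo (k : Fin n) (hki : k ≠ i) (hkj : k ≠ j) (ω : Ω) : w ω k = z ω k := by
    rw [hwk, hvk k hki hkj, mul_zero, add_zero]
  have hwm : AEStronglyMeasurable w P :=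
    hzm.add (hτm.aestronglyMeasurable.smul_const v)
  have hbd : ∀ᵐ ω ∂P, ∀ k, |w ω k| ≤ M := by
    filter_upwards [hz.1] with ω hω k
    rcases eq_or_ne k i with rfl | hki
    · rw [hwi]
      exact abs_add_transfer_le (f := fun ω => z ω k) hpi hs ht hiA hiB hqi hqi' (hω.1 k)
    rcases eq_or_ne k j with rfl | hkj
    · rw [hwj]
      exact abs_add_transfer_le (f := fun ω => z ω k) hpj ht hs hjB hjA hqj hqj' (hω.1 k)
    · rw [hwo k hki hkj]
      exact hω.1 k
  have hord (k : Fin n) (φ : ℝ → ℝ) (hφ : ConcaveOn ℝ univ φ) :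
      ∫ ω, φ (z ω k) ∂P ≤ ∫ ω, φ (w ω k) ∂P := by
    have hkm := aestronglyMeasurable_coord hzm k
    rcases eq_or_ne k i with rfl | hki
    · simp only [hwi]
      exact integral_comp_le_integral_comp_transfer hφ hkm (hz.bound k) hAm hBm hpi hs ht hiA hiB
        hqi hqi' hst
    rcases eq_or_ne k j with rfl | hkj
    · simp only [hwj]
      exact integral_comp_le_integral_comp_transfer hφ hkm (hz.bound k) hBm hAm hpj ht hs hjB hjA
        hqj hqj' hst.symm
    · simp only [hwo k hki hkj, le_refl]
  have hwL := memLp_two_of_abs_le hwm hbd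
  have hww : w =ᵐ[P] hwL.toLp w := (MemLp.coeFn_toLp hwL).symm
  have hwK : hwL.toLp w ∈ improvements P M y := by
    refine IsImprovement.congr ⟨?_, fun k φ hφ => (hz.2 k φ hφ).trans (hord k φ hφ)⟩ hww
    filter_upwards [hz.1, hbd] with ω h₁ h₂
    refine ⟨h₂, ?_⟩
    simp only [hwk, Finset.sum_add_distrib, ← Finset.mul_sum, hvsum, mul_zero, add_zero, h₁.2]
  have hnorm : ‖hwL.toLp w‖ ≤ ‖z‖ := by
    refine le_of_sq_le_sq ?_ (norm_nonneg _)
    rw [norm_sq_eq_sum_integral _ hwK.bound, norm_sq_eq_sum_integral _ hz.bound]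
    refine Finset.sum_le_sum fun k _ => ?_
    have hsq : ConcaveOn ℝ univ fun x : ℝ => -x ^ 2 := (even_two.convexOn_pow).neg
    have h := hord k _ hsq
    rw [integral_neg, integral_neg, neg_le_neg_iff] at h
    refine (integral_congr_ae ?_).trans_le h
    filter_upwards [hww] with ω hω
    rw [← hω]
  -- Uniqueness forces `w = z` a.e., yet on `A` the two differ by `s > 0` in component `i`.
  have heq := hmin _ hwK hnorm
  obtain ⟨ω, hωA, hω⟩ :=
    ((frequently_ae_mem_iff.2 hcon.1).and_eventually hww).exists
  rw [heq] at hω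
  have h1 := hwi ω
  have hωB : ω ∉ B := fun h => by linarith [h.1, hωA.1]
  rw [hω, transfer, indicator_of_mem hωA, indicator_of_notMem hωB] at h1
  linarith

/-- Comonotone improvement: every bounded allocation is dominated, componentwise in the concave
order, by a bounded comonotone allocation with the same total. -/
theorem exists_comonotone_isImprovement {M : ℝ} {y : Ω → EuclideanSpace ℝ (Fin n)}
    (hy : AEStronglyMeasurable y P) (hM : ∀ᵐ ω ∂P, ∀ i, |y ω i| ≤ M) :
    ∃ z : Ω → EuclideanSpace ℝ (Fin n), AEStronglyMeasurable z P ∧ IsImprovement P M y z ∧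
      ∃ A : Set Ω, (∀ᵐ ω ∂P, ω ∈ A) ∧ ∀ ω₁ ∈ A, ∀ ω₂ ∈ A, ∀ i j : Fin n,
        0 ≤ (z ω₁ i - z ω₂ i) * (z ω₁ j - z ω₂ j) := by
  obtain ⟨z, hz, hmin⟩ := exists_unique_minimal_improvement hy hM
  -- Rational thresholds leave only countably many null events to discard.
  refine ⟨z, Lp.aestronglyMeasurable z, hz, {ω | ∀ i j : Fin n, ∀ a a' b b' : ℚ,
    (P {ω | a' < z ω i ∧ z ω j < b} = 0 → ¬ (a' < z ω i ∧ z ω j < b)) ∧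
    (P {ω | z ω i < a ∧ b' < z ω j} = 0 → ¬ (z ω i < a ∧ b' < z ω j))}, ?_, ?_⟩
  · simp only [mem_ofPred_eq, ae_all_iff]
    intro i j a a' b b'
    refine Eventually.and ?_ ?_
    · by_cases h : P {ω | a' < z ω i ∧ z ω j < b} = 0
      · exact (measure_eq_zero_iff_ae_notMem.1 h).mono fun ω hω _ => hω
      · exact Eventually.of_forall fun ω h' => absurd h' h
    · by_cases h : P {ω | z ω i < a ∧ b' < z ω j} = 0
      · exact (measure_eq_zero_iff_ae_notMem.1 h).mono fun ω hω _ => hω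
      · exact Eventually.of_forall fun ω h' => absurd h' h
  · have key : ∀ ω₁ ω₂ : Ω, ∀ i j : Fin n, (∀ i j : Fin n, ∀ a a' b b' : ℚ,
        (P {ω | a' < z ω i ∧ z ω j < b} = 0 → ¬ (a' < z ω₁ i ∧ z ω₁ j < b)) ∧
        (P {ω | z ω i < a ∧ b' < z ω j} = 0 → ¬ (z ω₁ i < a ∧ b' < z ω₁ j))) →
        (∀ i j : Fin n, ∀ a a' b b' : ℚ,
        (P {ω | a' < z ω i ∧ z ω j < b} = 0 → ¬ (a' < z ω₂ i ∧ z ω₂ j < b)) ∧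
        (P {ω | z ω i < a ∧ b' < z ω j} = 0 → ¬ (z ω₂ i < a ∧ b' < z ω₂ j))) →
        ¬ (z ω₂ i < z ω₁ i ∧ z ω₁ j < z ω₂ j) := by
      rintro ω₁ ω₂ i j h₁ h₂ ⟨hi, hj⟩
      have hij : i ≠ j := by
        rintro rfl
        exact lt_asymm hi hj
      -- Rationals in the two gaps put `ω₁` in the first event and `ω₂` in the second; one of them
      -- is null and was discarded.
      obtain ⟨a, ha₁, ha₂⟩ := exists_rat_btwn hi
      obtain ⟨a', ha'₁, ha'₂⟩ := exists_rat_btwn ha₂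
      obtain ⟨b, hb₁, hb₂⟩ := exists_rat_btwn hj
      obtain ⟨b', hb'₁, hb'₂⟩ := exists_rat_btwn hb₂
      rcases measure_eq_zero_or_of_minimal hz hmin hij ha'₁ hb'₁ with h | h
      · exact (h₁ i j a a' b b').1 h ⟨ha'₂, hb₁⟩
      · exact (h₂ i j a a' b b').2 h ⟨ha₁, hb'₂⟩
    intro ω₁ h₁ ω₂ h₂ i j
    by_contra! hneg
    rcases mul_neg_iff.1 hneg with ⟨hi, hj⟩ | ⟨hi, hj⟩
    · exact key ω₁ ω₂ i j h₁ h₂ ⟨sub_pos.1 hi, sub_neg.1 hj⟩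
    · exact key ω₂ ω₁ i j h₂ h₁ ⟨sub_neg.1 hi, sub_pos.1 hj⟩

end Improvement

/-! ### Transfer to `Linf` and comparison of the optima. -/

section Market

variable {Ω : Type*} [MeasurableSpace Ω] {P : Measure Ω} {n : ℕ}

theorem ae_abs_le_norm (f : Linf P) : ∀ᵐ ω ∂P, |f ω| ≤ ‖f‖ := by
  have h := ae_le_eLpNormEssSup (f := f) (μ := P)
  filter_upwards [h] with ω hω
  rw [Lp.norm_def, eLpNorm_exponent_top, ← Real.norm_eq_abs, ← toReal_enorm]
  refine ENNReal.toReal_mono ?_ hω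
  rw [← eLpNorm_exponent_top]
  exact Lp.eLpNorm_ne_top f

theorem coeFn_sum (Y : Fin n → Linf P) :
    ∀ᵐ ω ∂P, (∑ i, Y i : Linf P) ω = ∑ i, Y i ω := by
  filter_upwards [Lp.coeFn_finsetSum Finset.univ Y] with ω h
  rw [h, Finset.sum_apply]

theorem coeFn_midpoint (f g : Linf P) :
    ∀ᵐ ω ∂P, ((1 / 2 : ℝ) • f + (1 / 2 : ℝ) • g : Linf P) ω =
      (1 / 2 : ℝ) • f ω + (1 / 2 : ℝ) • g ω := by
  filter_upwards [Lp.coeFn_add ((1 / 2 : ℝ) • f) ((1 / 2 : ℝ) • g),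
    Lp.coeFn_smul (1 / 2 : ℝ) f, Lp.coeFn_smul (1 / 2 : ℝ) g] with ω h₁ h₂ h₃
  rw [h₁, Pi.add_apply, h₂, h₃, Pi.smul_apply, Pi.smul_apply]

theorem paretoOptimal_inter_subset (U : Fin n → Linf P → ℝ) (X : Fin n → Linf P) :
    paretoOptimal U X ∩ comonotoneAllocations X ⊆ comonotoneParetoOptimal U X :=
  fun _ ⟨⟨hir, hpo⟩, hc⟩ => ⟨hc, hir, fun ⟨Y', _, h, hd⟩ => hpo ⟨Y', h, hd⟩⟩

variable [IsProbabilityMeasure P]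

/-- Every allocation is dominated, componentwise in the concave order, by a comonotone one. -/
theorem exists_comonotone_improvement (Y : Fin n → Linf P) :
    ∃ Z : Fin n → Linf P, ∑ i, Z i = ∑ i, Y i ∧ Comonotone Z ∧
      ∀ i, ∀ φ : ℝ → ℝ, ConcaveOn ℝ univ φ → ∫ ω, φ (Y i ω) ∂P ≤ ∫ ω, φ (Z i ω) ∂P := by
  set y : Ω → EuclideanSpace ℝ (Fin n) := fun ω => WithLp.toLp 2 fun i => Y i ω with hydef
  have hy : AEStronglyMeasurable y P := by
    refine ((PiLp.continuous_toLp 2 _).measurable.comp_aemeasurable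
      (aemeasurable_pi_lambda _ fun i => ?_)).aestronglyMeasurable
    exact (Lp.aestronglyMeasurable (Y i)).aemeasurable
  have hM : ∀ᵐ ω ∂P, ∀ i, |y ω i| ≤ ∑ k, ‖Y k‖ := by
    rw [ae_all_iff]
    intro i
    filter_upwards [ae_abs_le_norm (Y i)] with ω h
    exact h.trans (Finset.single_le_sum (f := fun k => ‖Y k‖) (fun k _ => norm_nonneg _)
      (Finset.mem_univ i))
  obtain ⟨z, hzm, hz, A, hA, hcom⟩ := exists_comonotone_isImprovement hy hM
  have hzL (i : Fin n) : MemLp (fun ω => z ω i) ∞ P :=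
    MemLp.of_bound (aestronglyMeasurable_coord hzm i) _ (hz.bound i)
  have hco : ∀ᵐ ω ∂P, ∀ i, (hzL i).toLp _ ω = z ω i :=
    ae_all_iff.2 fun i => MemLp.coeFn_toLp (hzL i)
  refine ⟨fun i => (hzL i).toLp _, ?_, ?_, fun i φ hφ => ?_⟩
  · apply Lp.ext
    filter_upwards [coeFn_sum Y, coeFn_sum fun i => (hzL i).toLp _, hco, hz.1]
      with ω h₁ h₂ h₃ h₄
    rw [h₁, h₂]
    simp only [h₃, h₄.2, hydef]
  · refine ⟨A ∩ {ω | ∀ i, (hzL i).toLp _ ω = z ω i}, hA.and hco, ?_⟩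
    rintro ω₁ ⟨h₁, e₁⟩ ω₂ ⟨h₂, e₂⟩ i j
    rw [e₁, e₁, e₂, e₂]
    exact hcom ω₁ h₁ ω₂ h₂ i j
  · refine (hz.2 i φ hφ).trans_eq (integral_congr_ae ?_)
    filter_upwards [hco] with ω h
    rw [h i]

theorem integrable_concave_comp {φ : ℝ → ℝ} (hφ : ConcaveOn ℝ univ φ) (f : Linf P) :
    Integrable (fun ω => φ (f ω)) P :=
  integrable_comp_of_bound (continuous_of_concaveOn hφ) (Lp.aestronglyMeasurable f)
    (ae_abs_le_norm f)

theorem ICVLe.midpoint {f g : Linf P} (h : ICVLe f g) :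
    ICVLe f ((1 / 2 : ℝ) • f + (1 / 2 : ℝ) • g) := by
  intro φ hmono hφ
  have hf := (integrable_concave_comp hφ f).const_mul (1 / 2 : ℝ)
  have hg := (integrable_concave_comp hφ g).const_mul (1 / 2 : ℝ)
  have hle := integral_mono_ae (hf.add hg) (integrable_concave_comp hφ _) (by
    filter_upwards [coeFn_midpoint f g] with ω hω
    rw [hω]
    exact hφ.2 (mem_univ _) (mem_univ _) (by norm_num) (by norm_num) (by norm_num))
  simp only [Pi.add_apply] at hle
  rw [integral_add hf hg, integral_const_mul, integral_const_mul] at hle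
  linarith [h φ hmono hφ]

/-- Equal integrals would force equality a.e. in the strict concavity inequality, hence `f = g`. -/
theorem ICVLe.midpoint_lt {f g : Linf P} (h : ICVLe f g) (hne : f ≠ g) :
    ICVLt f ((1 / 2 : ℝ) • f + (1 / 2 : ℝ) • g) := by
  refine ⟨h.midpoint, fun φ hmono hφ => ?_⟩
  have hf := (integrable_concave_comp hφ.concaveOn f).const_mul (1 / 2 : ℝ)
  have hg := (integrable_concave_comp hφ.concaveOn g).const_mul (1 / 2 : ℝ)
  have hm := integrable_concave_comp hφ.concaveOn ((1 / 2 : ℝ) • f + (1 / 2 : ℝ) • g)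
  have hle : (fun ω => 1 / 2 * φ (f ω) + 1 / 2 * φ (g ω)) ≤ᵐ[P]
      fun ω => φ (((1 / 2 : ℝ) • f + (1 / 2 : ℝ) • g : Linf P) ω) := by
    filter_upwards [coeFn_midpoint f g] with ω hω
    rw [hω]
    exact hφ.concaveOn.2 (mem_univ _) (mem_univ _) (by norm_num) (by norm_num) (by norm_num)
  have hint := integral_mono_ae (hf.add hg) hm hle
  have hlt : ∫ ω, (1 / 2 * φ (f ω) + 1 / 2 * φ (g ω)) ∂P <
      ∫ ω, φ (((1 / 2 : ℝ) • f + (1 / 2 : ℝ) • g : Linf P) ω) ∂P := by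
    refine lt_of_le_of_ne hint fun heq => hne (Lp.ext ?_)
    have hae := (integral_eq_iff_of_ae_le (hf.add hg) hm hle).1 heq
    filter_upwards [hae, coeFn_midpoint f g] with ω h₁ h₂
    by_contra hω
    have := hφ.2 (mem_univ _) (mem_univ _) hω (by norm_num : (0 : ℝ) < 1 / 2)
      (by norm_num : (0 : ℝ) < 1 / 2) (by norm_num)
    rw [h₂] at h₁
    exact this.ne h₁
  rw [integral_add hf hg, integral_const_mul, integral_const_mul] at hlt
  linarith [h φ hmono hφ.concaveOn]

theorem comonotoneParetoOptimal_subset {U : Fin n → Linf P → ℝ} {X : Fin n → Linf P}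
    (hU : ∀ i, SSDPreserving (U i)) :
    comonotoneParetoOptimal U X ⊆ paretoOptimal U X := by
  rintro Y ⟨_, hir, hcpo⟩
  refine ⟨hir, fun ⟨Y', hY', hle, k, hlt⟩ => hcpo ?_⟩
  obtain ⟨Z, hsum, hcom, hZ⟩ := exists_comonotone_improvement Y'
  have hUZ (i : Fin n) : U i (Y' i) ≤ U i (Z i) := hU i _ _ fun φ _ hφ => hZ i φ hφ
  have hall : Z ∈ allocations X := hsum.trans hY'.1
  exact ⟨Z, ⟨hall, hcom⟩, ⟨hall, fun i => (hY'.2 i).trans (hUZ i)⟩,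
    fun i => (hle i).trans (hUZ i), k, hlt.trans_le (hUZ k)⟩

theorem paretoOptimal_subset_comonotoneAllocations {U : Fin n → Linf P → ℝ}
    {X : Fin n → Linf P} (hU : ∀ i, SSDPreserving (U i))
    (hU' : ∀ i, StrictlySSDPreserving (U i)) :
    paretoOptimal U X ⊆ comonotoneAllocations X := by
  rintro Y ⟨hir, hpo⟩
  refine ⟨hir.1, ?_⟩
  obtain ⟨Z, hsum, hcom, hZ⟩ := exists_comonotone_improvement Y
  have hYZ (i : Fin n) : ICVLe (Y i) (Z i) := fun φ _ hφ => hZ i φ hφ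
  by_contra hY
  obtain ⟨k, hk⟩ : ∃ k, Y k ≠ Z k := by
    by_contra! h
    exact hY (funext h ▸ hcom)
  have hUW (i : Fin n) : U i (Y i) ≤ U i ((1 / 2 : ℝ) • Y i + (1 / 2 : ℝ) • Z i) :=
    hU i _ _ (hYZ i).midpoint
  -- `Z` itself may be only weakly better. The midpoint need not be comonotone, but optimality of
  -- `Y` is tested against all individually rational allocations.
  refine hpo ⟨fun i => (1 / 2 : ℝ) • Y i + (1 / 2 : ℝ) • Z i,
    ⟨?_, fun i => (hir.2 i).trans (hUW i)⟩, hUW, k, hU' k _ _ ((hYZ k).midpoint_lt hk)⟩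
  change ∑ i, ((1 / 2 : ℝ) • Y i + (1 / 2 : ℝ) • Z i) = ∑ i, X i
  rw [Finset.sum_add_distrib, ← Finset.smul_sum, ← Finset.smul_sum, hsum, ← add_smul]
  norm_num
  exact hir.1

end Market

end RiskSharing

theorem corollary3p9 {Ω : Type*} [MeasurableSpace Ω] (P : Measure Ω) [IsProbabilityMeasure P]
    (hP : RiskSharing.Atomless P) (n : ℕ) (X : Fin n → RiskSharing.Linf P)
    (U : Fin n → RiskSharing.Linf P → ℝ)
    (hconc : ∀ i, ConcaveOn ℝ Set.univ (U i))
    (hssd : ∀ i, RiskSharing.SSDPreserving (U i))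
    (hprem : ∀ i, RiskSharing.IncreasingInPremium (U i)) :
    RiskSharing.paretoOptimal U X ∩ RiskSharing.comonotoneAllocations X =
        RiskSharing.comonotoneParetoOptimal U X ∧
      ((∀ i, RiskSharing.StrictlySSDPreserving (U i)) →
        RiskSharing.paretoOptimal U X = RiskSharing.comonotoneParetoOptimal U X) := by
  have h : RiskSharing.paretoOptimal U X ∩ RiskSharing.comonotoneAllocations X =
      RiskSharing.comonotoneParetoOptimal U X :=
    (RiskSharing.paretoOptimal_inter_subset U X).antisymm fun Y hY =>
      ⟨RiskSharing.comonotoneParetoOptimal_subset hssd hY, hY.1⟩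
  refine ⟨h, fun hstrict => ?_⟩
  rw [← h, eq_comm, Set.inter_eq_left]
  exact RiskSharing.paretoOptimal_subset_comonotoneAllocations hssd hstrict
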